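/- Let $\mathbb S$ be the Sorgenfrey line, i.e. the set $\mathbb R$ with the topology generated by the half-intervals $[a,b)$, $a<b$, and let $C_k(\mathbb S)$ be the additive group of continuous functions $\mathbb S\to\mathbb R$ (with $\mathbb R$ carrying its usual topology), endowed with the compact-open topology. Call a topological space $X$ - *$k$-separable* if there is a countable set $D\subseteq X$ such that every compact set $K\subseteq X$ is contained in a compact set $\tilde K\subseteq X$ for which $D\cap\tilde K$ is dense in $\tilde K$; - *cosmic* if it is a continuous image of a separable metrizable space; - *cometrizable* if $X$ admits a weaker metrizable topology such that each point has a (not necessarily open) neighborhood base consisting of sets which are closed in the metrizable topology. The *spread* of $X$ is $s(X)=\sup\{|D| : D\subseteq X \text{ is a discrete subspace}\}$. The space $\mathbb S$ is $k$-separable and $C_k(\mathbb S)$ is cometrizable. Moreover, under the Continuum Hypothesis $\aleph_1=2^{\aleph_0}$, there are an uncountable subspace $X\subseteq\mathbb S$ whose countable power $X^\omega$ is hereditarily Lindelöf and a topological embedding $e:\mathbb S\to C_k(\mathbb S)$ such that the subgroup $G$ of $C_k(\mathbb S)$ generated by $e(X)$, with the subspace topology, has the following properties: $G$ is a cometrizable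 Abelian topological group; $G$ contains the uncountable subspace $X$ of the Sorgenfrey line (embedded by the restriction of $e$), and $G$ is not cosmic; the countable power $G^\omega$ is hereditarily Lindelöf and has countable spread $s(G^\omega)\le\aleph_0$. -/

import Mathlib

open Topology

universe u

/-- The Sorgenfrey line: the set of real numbers with the topology generated by the half-open
intervals `[a, b)`, `a < b`. -/
def SorgenfreyLine : Type := ℝ

instance SorgenfreyLine.instTopologicalSpace : TopologicalSpace SorgenfreyLine :=
  TopologicalSpace.generateFrom {s : Set ℝ | ∃ a b : ℝ, a < b ∧ s = Set.Ico a b}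

/-- A subset `D` of `X` is `k`-dense if every compact set `K` is contained in a compact set `L`
such that `D ∩ L` is dense in `L`. -/
def IsKDense {X : Type u} [TopologicalSpace X] (D : Set X) : Prop :=
  ∀ K : Set X, IsCompact K → ∃ L : Set X, IsCompact L ∧ K ⊆ L ∧ L ⊆ closure (D ∩ L)

/-- A space is `k`-separable if it contains a countable `k`-dense subset. -/
def IsKSeparable (X : Type u) [TopologicalSpace X] : Prop :=
  ∃ D : Set X, D.Countable ∧ IsKDense D

/-- A space is cosmic if it is a continuous image of a separable metrizable space.
(A separable metrizable space has at most continuum many points, so nothing is lost by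
taking it in the universe of `X`.) -/
def IsCosmic (X : Type u) [TopologicalSpace X] : Prop :=
  ∃ (M : Type u) (_ : TopologicalSpace M),
    TopologicalSpace.MetrizableSpace M ∧ TopologicalSpace.SeparableSpace M ∧
      ∃ f : M → X, Continuous f ∧ Function.Surjective f

/-- A space is cometrizable if it admits a weaker (that is, coarser) metrizable topology `σ` such
that each point has a base of (not necessarily open) neighborhoods that are `σ`-closed. -/
def IsCometrizable (X : Type u) [τ : TopologicalSpace X] : Prop :=
  ∃ σ : TopologicalSpace X, τ ≤ σ ∧ @TopologicalSpace.MetrizableSpace X σ ∧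
    ∀ x : X, ∀ U ∈ @nhds X τ x, ∃ V ∈ @nhds X τ x, V ⊆ U ∧ IsClosed[σ] V

/-- The spread of `X`: the supremum of the cardinalities of the discrete subspaces of `X`. -/
noncomputable def spread (X : Type u) [TopologicalSpace X] : Cardinal.{u} :=
  ⨆ D : {D : Set X // DiscreteTopology D}, Cardinal.mk D.1

/-!
The rationals are `k`-dense in the Sorgenfrey line: every compact set becomes compact again after
adding, for each `n`, the next points of the grid `ℤ / (n + 1)` strictly to the right of its points
(`SorgenfreyLine.isKSeparable`). Over a countable `k`-dense set `D`, pointwise convergence on `D` is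
a metrizable topology on `C(X, ℝ)`, and the uniform closed balls over compact sets `L` with `D ∩ L`
dense in `L` are closed in it; hence `C(X, ℝ)` and all its subspaces are cometrizable
(`IsKSeparable.isCometrizable_continuousMap`).

The embedding `SorgenfreyLine.stepMap` sends `x` to the indicator function of `[-x, ∞)`. The
indicator of `{(x, t) | 0 ≤ x + t}` is jointly continuous on the square of the Sorgenfrey line, so
currying it gives continuity into the compact-open topology, and evaluation at the points `-a`
recovers the half-open intervals.

Under the continuum hypothesis, a transfinite recursion of length `ω₁` based on the Baire category
theorem and the Kuratowski–Ulam theorem gives an injective family of reals whose injective tuples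
avoid any given closed nowhere dense set as soon as all their indices are large
(`exists_generic_family`). The part of a Sorgenfrey-open set outside its Euclidean interior is
nowhere dense, so in finite powers of the range `X` of the family it meets only tuples with an early
coordinate or a repeated one; by induction all finite powers of `X`, and hence `X^ω`, are
hereditarily Lindelöf (`SorgenfreyLine.isHereditarilyLindelof_pow`,
`HereditarilyLindelofSpace.pi_nat`). The countable power of the group `G` generated by the copy of
`X` is a continuous image of `ℕ^ω × X^ω`, so it is hereditarily Lindelöf as well
(`HereditarilyLindelofSpace.pi_nat_addSubgroup_closure`), whence its countable spread. It is not
cosmic because an uncountable subspace of the Sorgenfrey line has no countable network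
(`SorgenfreyLine.not_isCosmic_of_stepMap_mem`).
-/

open Set Filter

/-! ### The Sorgenfrey line -/

namespace SorgenfreyLine

/-- The identity map from the Sorgenfrey line to the real line. -/
def toReal : SorgenfreyLine ≃ ℝ := Equiv.refl ℝ

theorem isOpen_preimage_Ico (a b : ℝ) : IsOpen (toReal ⁻¹' Ico a b) := by
  rcases lt_or_ge a b with h | h
  · exact TopologicalSpace.isOpen_generateFrom_of_mem ⟨a, b, h, rfl⟩
  · simp [Ico_eq_empty (not_lt.2 h)]

theorem nhds_eq_comap (x : SorgenfreyLine) : 𝓝 x = comap toReal (𝓝[≥] (toReal x)) := by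
  apply le_antisymm
  · refine ((nhdsGE_basis (toReal x)).comap toReal).ge_iff.2 fun b hb => ?_
    exact (isOpen_preimage_Ico _ _).mem_nhds ⟨le_rfl, hb⟩
  · rw [TopologicalSpace.nhds_generateFrom]
    refine le_iInf₂ fun s hs => le_principal_iff.2 ?_
    obtain ⟨hx, a, b, -, rfl⟩ := hs
    exact preimage_mem_comap (Ico_mem_nhdsGE_of_mem hx)

theorem nhds_hasBasis (x : SorgenfreyLine) :
    (𝓝 x).HasBasis (fun b => toReal x < b) fun b => toReal ⁻¹' Ico (toReal x) b := by
  rw [nhds_eq_comap]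
  exact (nhdsGE_basis (toReal x)).comap toReal

theorem continuous_toReal : Continuous toReal := by
  refine continuous_iff_continuousAt.2 fun x => ?_
  rw [ContinuousAt, nhds_eq_comap]
  exact tendsto_comap.mono_right nhdsWithin_le_nhds

/-- The least point of the grid `ℤ / (n + 1)` lying strictly to the right of `x`. -/
noncomputable def nextGrid (n : ℕ) (x : ℝ) : ℝ := (⌊((n : ℝ) + 1) * x⌋ + 1) / ((n : ℝ) + 1)

theorem lt_nextGrid (n : ℕ) (x : ℝ) : x < nextGrid n x := by
  have hn : (0 : ℝ) < (n : ℝ) + 1 := by positivity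
  rw [nextGrid, lt_div_iff₀ hn, mul_comm]
  exact Int.lt_floor_add_one _

theorem nextGrid_le (n : ℕ) (x : ℝ) : nextGrid n x ≤ x + 1 / ((n : ℝ) + 1) := by
  have hn : (0 : ℝ) < (n : ℝ) + 1 := by positivity
  rw [nextGrid, div_le_iff₀ hn, add_mul x, div_mul_cancel₀ _ hn.ne', mul_comm x]
  linarith [Int.floor_le (((n : ℝ) + 1) * x)]

theorem nextGrid_eq_of_mem_Ico (n : ℕ) {x y : ℝ} (h : y ∈ Ico x (nextGrid n x)) :
    nextGrid n y = nextGrid n x := by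
  have hn : (0 : ℝ) < (n : ℝ) + 1 := by positivity
  have : ⌊((n : ℝ) + 1) * y⌋ = ⌊((n : ℝ) + 1) * x⌋ := by
    refine Int.floor_eq_iff.2 ⟨(Int.floor_le _).trans (by gcongr; exact h.1), ?_⟩
    have h2 := h.2
    rwa [nextGrid, lt_div_iff₀ hn, mul_comm] at h2
  rw [nextGrid, this, nextGrid]

theorem nextGrid_mem_range_ratCast (n : ℕ) (x : ℝ) :
    nextGrid n x ∈ range ((↑) : ℚ → ℝ) :=
  ⟨(⌊((n : ℝ) + 1) * x⌋ + 1) / ((n : ℚ) + 1), by simp [nextGrid]⟩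

/-- The grid approximations from the right together with their limit, the identity at `∞`, as a
single map. -/
noncomputable def gridApprox (p : SorgenfreyLine × OnePoint ℕ) : SorgenfreyLine :=
  p.2.elim p.1 fun n => toReal.symm (nextGrid n (toReal p.1))

theorem continuous_gridApprox : Continuous gridApprox := by
  refine continuous_iff_continuousAt.2 ?_
  rintro ⟨x, n⟩
  induction n using OnePoint.rec with
  | infty =>
    refine (nhds_hasBasis _).tendsto_right_iff.2 fun b hb => ?_
    change toReal x < b at hb
    obtain ⟨N, hN⟩ := exists_nat_one_div_lt (show (0 : ℝ) < (b - toReal x) / 2 by linarith)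
    have hT : ((↑) '' Iio N : Set (OnePoint ℕ))ᶜ ∈ 𝓝 (OnePoint.infty : OnePoint ℕ) :=
      (OnePoint.isOpen_compl_image_coe.2 ⟨isClosed_discrete _,
        (finite_Iio N).isCompact⟩).mem_nhds (by simp)
    have hS := (nhds_hasBasis x).mem_of_mem
      (show toReal x < toReal x + (b - toReal x) / 2 by linarith)
    rw [nhds_prod_eq]
    filter_upwards [prod_mem_prod hS hT]
    rintro ⟨y, m⟩ ⟨⟨hy1, hy2⟩, hm⟩
    dsimp only at hy1 hy2 hm
    induction m using OnePoint.rec with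
    | infty =>
      exact ⟨hy1, by change toReal y < b; linarith⟩
    | coe m =>
      have hm' : N ≤ m := by
        by_contra hlt
        exact hm ⟨m, not_le.1 hlt, rfl⟩
      have h1 := lt_nextGrid m (toReal y)
      have h2 := nextGrid_le m (toReal y)
      have h3 : 1 / ((m : ℝ) + 1) ≤ 1 / ((N : ℝ) + 1) := by gcongr
      exact ⟨by change toReal x ≤ nextGrid m (toReal y); linarith,
        by change nextGrid m (toReal y) < b; linarith⟩
  | coe n =>
    have hS := (nhds_hasBasis x).mem_of_mem (lt_nextGrid n (toReal x))
    rw [ContinuousAt, nhds_prod_eq, OnePoint.nhds_coe_eq, nhds_discrete ℕ, map_pure]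
    refine tendsto_nhds_of_eventually_eq ?_
    filter_upwards [prod_mem_prod hS (show {(n : OnePoint ℕ)} ∈ pure (n : OnePoint ℕ) from rfl)]
    rintro ⟨y, m⟩ ⟨hy, rfl⟩
    exact congrArg toReal.symm (nextGrid_eq_of_mem_Ico n hy)

/-- The rationals are `k`-dense: a compact set `K` together with its right grid approximations is
the image of the compact set `K ×ˢ univ` under `gridApprox`. -/
theorem isKSeparable : IsKSeparable SorgenfreyLine := by
  refine ⟨range fun q : ℚ => toReal.symm q, countable_range _, fun K hK => ?_⟩
  refine ⟨gridApprox '' (K ×ˢ univ), (hK.prod isCompact_univ).image continuous_gridApprox,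
    fun x hx => ⟨(x, OnePoint.infty), ⟨hx, mem_univ _⟩, rfl⟩, ?_⟩
  have hcoe : ∀ x ∈ K, ∀ n : ℕ, gridApprox (x, n) ∈
      (range fun q : ℚ => toReal.symm q) ∩ gridApprox '' (K ×ˢ univ) := by
    intro x hx n
    obtain ⟨q, hq⟩ := nextGrid_mem_range_ratCast n (toReal x)
    exact ⟨⟨q, congrArg toReal.symm hq⟩, (x, n), ⟨hx, mem_univ _⟩, rfl⟩
  rintro _ ⟨⟨x, n⟩, ⟨hx, -⟩, rfl⟩
  induction n using OnePoint.rec with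
  | coe n => exact subset_closure (hcoe x hx n)
  | infty =>
    have ht : Tendsto (fun n : ℕ => gridApprox (x, n)) atTop
        (𝓝 (gridApprox (x, OnePoint.infty))) := by
      refine continuous_gridApprox.continuousAt.tendsto.comp ?_
      refine tendsto_const_nhds.prodMk_nhds ?_
      have := OnePoint.tendsto_coe_infty (X := ℕ)
      rwa [coclosedCompact_eq_cocompact, cocompact_eq_cofinite, Nat.cofinite_eq_atTop] at this
    exact mem_closure_of_tendsto ht (Eventually.of_forall (hcoe x hx))

end SorgenfreyLine

/-! ### Cometrizable spaces -/

/-- The coarser metrizable topology is that of pointwise convergence on a countable `k`-dense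
set. -/
theorem IsKSeparable.isCometrizable_continuousMap {X : Type u} [TopologicalSpace X]
    (h : IsKSeparable X) : IsCometrizable C(X, ℝ) := by
  obtain ⟨D, hDc, hD⟩ := h
  have := hDc.to_subtype
  let r : C(X, ℝ) → D → ℝ := fun f d => f d
  have hr : Continuous r := by fun_prop
  have hDd : Dense D := fun x => by
    obtain ⟨L, -, hxL, hL⟩ := hD {x} isCompact_singleton
    exact closure_mono inter_subset_left (hL (hxL rfl))
  have hinj : Function.Injective r := fun f g hfg =>
    DFunLike.coe_injective (f.continuous.ext_on hDd g.continuous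
      fun d hd => congrFun hfg ⟨d, hd⟩)
  refine ⟨.induced r inferInstance, continuous_iff_le_induced.1 hr, ?_, fun f U hU => ?_⟩
  · let _ : TopologicalSpace C(X, ℝ) := .induced r inferInstance
    exact (IsEmbedding.mk ⟨rfl⟩ hinj).metrizableSpace
  · obtain ⟨⟨K, ε⟩, ⟨hK, hε⟩, hKU⟩ := (nhds_basis_uniformity'
      Metric.uniformity_basis_dist_le.compactConvergenceUniformity).mem_iff.1 hU
    obtain ⟨L, hL, hKL, hLD⟩ := hD K hK
    refine ⟨{g | ∀ x ∈ L, dist (f x) (g x) ≤ ε}, (nhds_basis_uniformity'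
      Metric.uniformity_basis_dist_le.compactConvergenceUniformity).mem_of_mem (i := (L, ε))
        ⟨hL, hε⟩, fun g hg => hKU fun x hx => hg x (hKL hx), ?_⟩
    -- By density of `D ∩ L` in `L`, the estimate need only be required at the points of `D ∩ L`.
    refine isClosed_induced_iff.2 ⟨{h | ∀ d : D, (d : X) ∈ L → dist (f d) (h d) ≤ ε}, ?_, ?_⟩
    · simp only [ofPred_forall]
      exact isClosed_iInter fun d => isClosed_iInter fun _ =>
        isClosed_le (continuous_const.dist (continuous_apply d)) continuous_const
    · ext g
      refine ⟨fun hg x hx => ?_, fun hg d hd => hg d hd⟩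
      have hcl : IsClosed {y | dist (f y) (g y) ≤ ε} :=
        isClosed_le (by fun_prop) continuous_const
      exact closure_minimal (fun y hy => hg ⟨y, hy.1⟩ hy.2) hcl (hLD hx)

theorem IsCometrizable.subtype {X : Type u} [TopologicalSpace X] (h : IsCometrizable X)
    (s : Set X) : IsCometrizable s := by
  have hnhds : ∀ (x : s) (U : Set s), U ∈ 𝓝 x ↔ ∃ u ∈ 𝓝 (x : X), Subtype.val ⁻¹' u ⊆ U :=
    mem_nhds_subtype s
  obtain ⟨σ, hσ, hm, hb⟩ := h
  refine ⟨.induced Subtype.val σ, induced_mono hσ, ?_, fun x U hU => ?_⟩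
  · exact @IsEmbedding.metrizableSpace _ _ (.induced Subtype.val σ) σ hm _
      (@IsEmbedding.subtypeVal X σ _)
  · obtain ⟨W, hW, hWU⟩ := (hnhds x U).1 hU
    obtain ⟨V, hV, hVW, hVc⟩ := hb x.1 W hW
    exact ⟨Subtype.val ⁻¹' V, (hnhds x _).2 ⟨V, hV, Subset.rfl⟩, (preimage_mono hVW).trans hWU,
      @IsClosed.preimage _ _ (.induced Subtype.val σ) σ _ (@continuous_induced_dom _ _ _ σ) _ hVc⟩

/-! ### Hereditarily Lindelöf spaces -/

theorem IsHereditarilyLindelof.image {Y Z : Type*} [TopologicalSpace Y] [TopologicalSpace Z]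
    {s : Set Y} (hs : IsHereditarilyLindelof s) {f : Y → Z} (hf : Continuous f) :
    IsHereditarilyLindelof (f '' s) := by
  intro t ht
  have : f '' (s ∩ f ⁻¹' t) = t := by rwa [image_inter_preimage, inter_eq_right]
  exact this ▸ (hs.isLindelof_subset inter_subset_left).image hf

theorem HereditarilyLindelofSpace.of_surjective {Y Z : Type*} [TopologicalSpace Y]
    [TopologicalSpace Z] [HereditarilyLindelofSpace Y] {f : Y → Z} (hf : Continuous f)
    (hsurj : Function.Surjective f) : HereditarilyLindelofSpace Z :=
  ⟨by simpa [hsurj.range_eq] using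
    (HereditarilyLindelofSpace.isHereditarilyLindelof_univ (X := Y)).image hf⟩

/-- A space is hereditarily Lindelöf as soon as it has a base formed by the sets
`S k ∩ f k ⁻¹' V`, with `k` in a countable index type and `V` open in a hereditarily Lindelöf
space `Z k`. The maps `f k` need not be continuous. -/
theorem HereditarilyLindelofSpace.of_countable_family {Y κ : Type*} [TopologicalSpace Y]
    [Countable κ] {Z : κ → Type*} [∀ k, TopologicalSpace (Z k)]
    [∀ k, HereditarilyLindelofSpace (Z k)] (S : κ → Set Y) (f : ∀ k, Y → Z k)
    (h : ∀ W : Set Y, IsOpen W → ∀ y ∈ W, ∃ k, y ∈ S k ∧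
      ∃ V, IsOpen V ∧ f k y ∈ V ∧ S k ∩ f k ⁻¹' V ⊆ W) :
    HereditarilyLindelofSpace Y := by
  refine ⟨fun t _ => isLindelof_of_countable_subcover fun {ι} U hU htU => ?_⟩
  -- The largest `V i` whose trace on `S k` lies inside `U i`; for fixed `k` countably many suffice.
  let V : ∀ k, ι → Set (Z k) := fun k i => ⋃₀ {V | IsOpen V ∧ S k ∩ f k ⁻¹' V ⊆ U i}
  have hV : ∀ k i, IsOpen (V k i) := fun k i => isOpen_sUnion fun _ h => h.1
  choose T hTc hT using fun k => eq_open_union_countable (V k) (hV k)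
  refine ⟨⋃ k, T k, countable_iUnion hTc, fun y hy => ?_⟩
  obtain ⟨i, hi⟩ := mem_iUnion.1 (htU hy)
  obtain ⟨k, hyk, W, hW, hyW, hWU⟩ := h _ (hU i) y hi
  have hyV : f k y ∈ ⋃ i ∈ T k, V k i := by
    rw [hT k]
    exact mem_iUnion.2 ⟨i, W, ⟨hW, hWU⟩, hyW⟩
  obtain ⟨i', hi', W', ⟨-, hW'⟩, hyW'⟩ := mem_iUnion₂.1 hyV
  exact mem_iUnion₂.2 ⟨i', mem_iUnion.2 ⟨k, hi'⟩, hW' ⟨hyk, hyW'⟩⟩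

theorem HereditarilyLindelofSpace.pi_nat {X : Type*} [TopologicalSpace X]
    (h : ∀ n : ℕ, HereditarilyLindelofSpace (Fin n → X)) : HereditarilyLindelofSpace (ℕ → X) := by
  refine .of_countable_family (κ := ℕ) (Z := fun n => Fin n → X) (fun _ => univ)
    (fun n y (i : Fin n) => y i) fun W hW y hy => ?_
  obtain ⟨I, u, hu, hIW⟩ := isOpen_pi_iff.1 hW y hy
  refine ⟨I.sup id + 1, mem_univ _, {z | ∀ i : Fin (I.sup id + 1), (i : ℕ) ∈ I → z i ∈ u i}, ?_,
    fun i hi => (hu i hi).2, fun z hz => hIW fun i hi => ?_⟩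
  · simp only [ofPred_forall]
    exact isOpen_iInter_of_finite fun i => isOpen_iInter_of_finite fun hi =>
      (hu i hi).1.preimage (continuous_apply i)
  · exact hz.2 ⟨i, Nat.lt_succ_of_le (Finset.le_sup (f := id) hi)⟩ hi

instance HereditarilyLindelofSpace.prod {P Y : Type*} [TopologicalSpace P] [TopologicalSpace Y]
    [SecondCountableTopology P] [HereditarilyLindelofSpace Y] :
    HereditarilyLindelofSpace (P × Y) := by
  have hb := TopologicalSpace.isBasis_countableBasis P
  have := (TopologicalSpace.countable_countableBasis P).to_subtype
  refine .of_countable_family (κ := TopologicalSpace.countableBasis P) (Z := fun _ => Y)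
    (fun B => Prod.fst ⁻¹' (B : Set P)) (fun _ => Prod.snd) fun W hW y hy => ?_
  obtain ⟨u, v, hu, hv, hyu, hyv, huv⟩ := isOpen_prod_iff.1 hW y.1 y.2 hy
  obtain ⟨B, hB, hyB, hBu⟩ := hb.exists_subset_of_mem_open hyu hu
  exact ⟨⟨B, hB⟩, hyB, v, hv, hyv, fun z hz => huv ⟨hBu hz.1, hz.2⟩⟩

theorem spread_le_aleph0 (X : Type u) [TopologicalSpace X] [HereditarilyLindelofSpace X] :
    spread X ≤ Cardinal.aleph0 := by
  refine ciSup_le' fun ⟨D, hD⟩ => ?_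
  have hD' : IsLindelof (univ : Set D) :=
    isLindelof_iff_isLindelof_univ.1 (HereditarilyLindelofSpace.isLindelof D)
  exact Cardinal.mk_le_aleph0_iff.2 (countable_univ_iff.1 hD'.countable_of_discrete)

/-! ### Generic families of reals -/

/-- `slice U J s` is the set of points that land in `U` once their coordinates in `J` are replaced
by those of `s`. -/
def slice {ι : Type*} [DecidableEq ι] (U : Set (ι → ℝ)) (J : Finset ι) (s : ι → ℝ) :
    Set (ι → ℝ) :=
  {v | J.piecewise s v ∈ U}

theorem IsOpen.slice {ι : Type*} [DecidableEq ι] {U : Set (ι → ℝ)} (hU : IsOpen U)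
    (J : Finset ι) (s : ι → ℝ) : IsOpen (slice U J s) := by
  refine hU.preimage (continuous_pi fun i => ?_)
  by_cases hi : i ∈ J <;> simp [hi] <;> fun_prop

theorem slice_insert {ι : Type*} [DecidableEq ι] (U : Set (ι → ℝ)) {J : Finset ι} {j : ι}
    (hj : j ∉ J) (s : ι → ℝ) :
    slice U (insert j J) s = {v | Function.update v j (s j) ∈ slice U J s} := by
  ext v
  have : (insert j J).piecewise s v = J.piecewise s (Function.update v j (s j)) := by
    ext i
    rcases eq_or_ne i j with rfl | hij
    · simp [hj]
    · by_cases hi : i ∈ J <;> simp [hi, hij]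
  simp only [slice, mem_ofPred_eq, this]

/-- The Kuratowski–Ulam theorem for one coordinate of a finite power of the line: almost all
sections of a dense open set, in the sense of category, are dense. -/
theorem eventually_residual_dense_update {ι : Type*} [Fintype ι] [DecidableEq ι]
    {E : Set (ι → ℝ)} (ho : IsOpen E) (hd : Dense E) (j : ι) :
    ∀ᶠ t in residual ℝ, Dense {v | Function.update v j t ∈ E} := by
  let b := TopologicalSpace.countableBasis (ι → ℝ)
  have hb := TopologicalSpace.isBasis_countableBasis (ι → ℝ)
  have hbc := (TopologicalSpace.countable_countableBasis (ι → ℝ)).to_subtype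
  have key : ∀ᶠ t in residual ℝ, ∀ B : b, ∃ v ∈ B.1, Function.update v j t ∈ E := by
    refine eventually_countable_forall.2 fun B => residual_of_dense_open ?_ ?_
    · have : {t : ℝ | ∃ v ∈ B.1, Function.update v j t ∈ E} =
          ⋃ v ∈ B.1, (fun t : ℝ => Function.update v j t) ⁻¹' E := by ext; simp
      change IsOpen {t : ℝ | ∃ v ∈ B.1, Function.update v j t ∈ E}
      rw [this]
      exact isOpen_biUnion fun v _ => ho.preimage (by fun_prop)
    · refine dense_iff_inter_open.2 fun T hT hTn => ?_
      obtain ⟨v, hv⟩ := TopologicalSpace.nonempty_of_mem_countableBasis B.2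
      obtain ⟨t, ht⟩ := hTn
      have hO : IsOpen {w : ι → ℝ | w j ∈ T ∧ ∃ t', Function.update w j t' ∈ B.1} := by
        refine (hT.preimage (continuous_apply j)).inter (t := {w | ∃ t', _}) ?_
        simp only [ofPred_exists]
        exact isOpen_iUnion fun t' => (hb.isOpen B.2).preimage
          (show Continuous fun w : ι → ℝ => Function.update w j t' by fun_prop)
      obtain ⟨w, ⟨hwT, t', hw⟩, hwE⟩ := hd.inter_open_nonempty _ hO
        ⟨Function.update v j t, by simpa using ht, v j, by simpa using hv⟩
      exact ⟨w j, hwT, _, hw, by simpa using hwE⟩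
  filter_upwards [key] with t ht
  refine hb.dense_iff.2 fun B hB hBn => ?_
  obtain ⟨v, hv, hvE⟩ := ht ⟨B, hB⟩
  exact ⟨v, hv, hvE⟩

/-- The open dense subsets of the finite powers of the line. -/
abbrev DenseOpen : Type := Σ n : ℕ, {U : Set (Fin n → ℝ) // IsOpen U ∧ Dense U}

theorem mk_denseOpen_le : Cardinal.mk DenseOpen ≤ Cardinal.continuum := by
  have h : ∀ n : ℕ, Cardinal.mk {U : Set (Fin n → ℝ) // IsOpen U ∧ Dense U} ≤
      Cardinal.continuum := by
    intro n
    let b := TopologicalSpace.countableBasis (Fin n → ℝ)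
    have hb := TopologicalSpace.isBasis_countableBasis (Fin n → ℝ)
    have hbc := (TopologicalSpace.countable_countableBasis (Fin n → ℝ)).to_subtype
    have hinj : Function.Injective
        fun (U : {U : Set (Fin n → ℝ) // IsOpen U ∧ Dense U}) => {B : b | B.1 ⊆ U.1} := by
      intro U V hUV
      have hUV' : ∀ B ∈ b, B ⊆ U.1 ↔ B ⊆ V.1 := fun B hB => Set.ext_iff.1 hUV ⟨B, hB⟩
      have hset : {B ∈ b | B ⊆ U.1} = {B ∈ b | B ⊆ V.1} := by
        ext B; exact and_congr_right (hUV' B)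
      exact Subtype.ext ((hb.open_eq_sUnion' U.2.1).trans
        ((congrArg sUnion hset).trans (hb.open_eq_sUnion' V.2.1).symm))
    refine (Cardinal.mk_le_of_injective hinj).trans ?_
    rw [Cardinal.mk_set, ← Cardinal.two_power_aleph0]
    exact Cardinal.power_le_power_left two_ne_zero (Cardinal.mk_le_aleph0)
  rw [Cardinal.mk_sigma]
  refine (Cardinal.sum_le_sum _ _ h).trans ?_
  simp

/-- A real `t` is generic over a family `𝒰` of dense open sets and a set `C` of reals if it lies
outside `C` and any dense slice of a member of `𝒰`, taken along finitely many coordinates with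
values in `C`, stays dense when one further coordinate is given the value `t`. -/
def IsGenericOver (𝒰 : Set DenseOpen) (C : Set ℝ) (t : ℝ) : Prop :=
  t ∉ C ∧ ∀ U ∈ 𝒰, ∀ (J : Finset (Fin U.1)) (s : Fin U.1 → ℝ), (∀ i ∈ J, s i ∈ C) →
    Dense (slice U.2.1 J s) → ∀ j ∉ J, Dense {v | Function.update v j t ∈ slice U.2.1 J s}

theorem exists_isGenericOver {𝒰 : Set DenseOpen} (h𝒰 : 𝒰.Countable) {C : Set ℝ}
    (hC : C.Countable) : ∃ t, IsGenericOver 𝒰 C t := by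
  have := h𝒰.to_subtype
  have := (hC.insert 0).to_subtype
  have h1 : ∀ᶠ t in residual ℝ, t ∉ C := by
    have : ∀ᶠ t : ℝ in residual ℝ, ∀ c : (insert 0 C : Set ℝ), t ≠ (c : ℝ) :=
      eventually_countable_forall.2 fun c =>
        residual_of_dense_open isOpen_compl_singleton (dense_compl_singleton c.1)
    filter_upwards [this] with t ht htC
    exact ht ⟨t, mem_insert_of_mem _ htC⟩ rfl
  -- Only the values of `s` on `J` matter; the others are set to `0` to keep the family countable.
  have h2 : ∀ᶠ t in residual ℝ, ∀ (U : 𝒰) (J : Finset (Fin U.1.1))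
      (s : Fin U.1.1 → (insert 0 C : Set ℝ)) (j : Fin U.1.1),
      Dense (slice U.1.2.1 J fun i => (s i : ℝ)) →
      Dense {v | Function.update v j t ∈ slice U.1.2.1 J fun i => (s i : ℝ)} := by
    simp only [eventually_countable_forall]
    intro U J s j
    by_cases hd : Dense (slice U.1.2.1 J fun i => (s i : ℝ))
    · simpa [hd] using eventually_residual_dense_update (U.1.2.2.1.slice J _) hd j
    · simp [hd]
  obtain ⟨t, ht1, ht2⟩ := (dense_of_mem_residual (h1.and h2)).nonempty
  refine ⟨t, ht1, fun U hU J s hs hd j _ => ?_⟩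
  have hslice : slice U.2.1 J s =
      slice U.2.1 J fun i => if i ∈ J then s i else 0 := by
    have : ∀ v, J.piecewise s v = J.piecewise (fun i => if i ∈ J then s i else 0) v := fun v => by
      ext i; by_cases hi : i ∈ J <;> simp [hi]
    ext v
    simp only [slice, mem_ofPred_eq, this v]
  rw [hslice] at hd ⊢
  refine ht2 ⟨U, hU⟩ J (fun i => ⟨if i ∈ J then s i else 0, ?_⟩) j hd
  split_ifs with hi
  · exact mem_insert_of_mem _ (hs i hi)
  · exact mem_insert _ _

/-- Under the continuum hypothesis there is a strong form of a Luzin set: for every closed nowhere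
dense subset of a finite power of the line, all injective tuples with indices beyond some `b` avoid
it. The index type is `ω₁`. By recursion, `x a` is generic over the points chosen before it and the
dense open sets enumerated up to `a`; the continuum hypothesis makes such an enumeration exhaust
all dense open sets. -/
theorem exists_generic_family (hCH : Cardinal.aleph.{0} 1 = Cardinal.continuum.{0}) :
    ∃ (I : Type) (_ : LinearOrder I) (x : I → ℝ), Uncountable I ∧ (∀ a : I, (Iio a).Countable) ∧
      Function.Injective x ∧
      ∀ (n : ℕ) (U : Set (Fin n → ℝ)), IsOpen U → Dense U → ∃ b : I, ∀ a : Fin n → I,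
        Function.Injective a → (∀ i, b ≤ a i) → x ∘ a ∈ U := by
  let I : Type := (Cardinal.aleph.{0} 1).ord.ToType
  have hmk : Cardinal.mk I = Cardinal.aleph 1 := Cardinal.mk_ord_toType _
  have hunc : Uncountable I := by
    rw [← Cardinal.aleph0_lt_mk_iff, hmk]; exact Cardinal.aleph0_lt_aleph_one
  have hcount : ∀ a : I, (Iio a).Countable := by
    intro a
    have := (Cardinal.mk_Iio_lt a (by simp [I])).trans_eq hmk
    rwa [← Cardinal.le_aleph0_iff_set_countable, ← Order.lt_succ_iff, Cardinal.succ_aleph0]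
  have hcount' : ∀ a : I, (Iic a).Countable := fun a => by
    rw [← Iio_insert]; exact (hcount a).insert a
  have : Nonempty DenseOpen := ⟨⟨0, univ, isOpen_univ, dense_univ⟩⟩
  obtain ⟨code, hcode⟩ : ∃ code : I → DenseOpen, Function.Surjective code := by
    obtain ⟨g⟩ : Nonempty (DenseOpen ↪ I) := by
      rw [← Cardinal.le_def, hmk, hCH]; exact mk_denseOpen_le
    exact ⟨Function.invFun g, Function.invFun_surjective g.injective⟩
  obtain ⟨x, hx⟩ : ∃ x : I → ℝ, ∀ a, IsGenericOver (code '' Iic a) (x '' Iio a) (x a) := by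
    have hex : ∀ (a : I) (f : ∀ b, b < a → ℝ), ∃ t,
        IsGenericOver (code '' Iic a) (range fun b : Iio a => f b.1 b.2) t := fun a f => by
      have := (hcount a).to_subtype
      exact exists_isGenericOver ((hcount' a).image _) (countable_range _)
    choose F hF using hex
    have wf : WellFounded ((· < ·) : I → I → Prop) := wellFounded_lt
    refine ⟨wf.fix F, fun a => ?_⟩
    have := hF a fun b _ => wf.fix F b
    rw [← wf.fix_eq F a] at this
    rwa [show wf.fix F '' Iio a = range fun b : Iio a => wf.fix F b.1 from image_eq_range ..]
  have hxinj : Function.Injective x := by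
    intro a b hab
    by_contra hne
    rcases lt_or_gt_of_ne hne with h | h
    · exact (hx b).1 ⟨a, h, hab⟩
    · exact (hx a).1 ⟨b, h, hab.symm⟩
  refine ⟨I, inferInstance, x, hunc, hcount, hxinj, fun n U ho hd => ?_⟩
  obtain ⟨b, hb⟩ := hcode ⟨n, U, ho, hd⟩
  refine ⟨b, fun a ha hba => ?_⟩
  -- The coordinates are fixed in increasing order of their indices.
  have key : ∀ J : Finset (Fin n), Dense (slice U J (x ∘ a)) := by
    intro J
    induction J using Finset.induction_on_max_value a with
    | empty => simpa [slice] using hd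
    | insert j J hj hmax ih =>
      rw [slice_insert U hj]
      refine (hx (a j)).2 ⟨n, U, ho, hd⟩ ⟨b, hba j, hb⟩ J (x ∘ a) (fun i hi => ?_) ih j hj
      exact ⟨a i, lt_of_le_of_ne (hmax i hi) fun h => hj (ha h ▸ hi), rfl⟩
  obtain ⟨v, hv⟩ := (key Finset.univ).nonempty
  simpa [slice] using hv

/-! ### Powers of generic subspaces of the Sorgenfrey line -/

namespace SorgenfreyLine

theorem subset_closure_interior_of_isOpen {ι : Type*} [Finite ι] {U : Set (ι → SorgenfreyLine)}
    (hU : IsOpen U) :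
    {q : ι → ℝ | (fun k => toReal.symm (q k)) ∈ U} ⊆
      closure (interior {q : ι → ℝ | (fun k => toReal.symm (q k)) ∈ U}) := by
  intro p hp
  obtain ⟨u, hu, huU⟩ := isOpen_pi_iff'.1 hU _ hp
  choose b hb hbu using fun k => (nhds_hasBasis _).mem_iff.1 ((hu k).1.mem_nhds (hu k).2)
  have hsub : pi univ (fun k => Ioo (p k) (b k)) ⊆
      interior {q : ι → ℝ | (fun k => toReal.symm (q k)) ∈ U} :=
    interior_maximal (fun q hq => huU fun k _ => hbu k ⟨(hq k trivial).1.le, (hq k trivial).2⟩)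
      (isOpen_set_pi finite_univ fun _ _ => isOpen_Ioo)
  refine closure_mono hsub ?_
  rw [closure_pi_set]
  intro k _
  have hk : p k < b k := hb k
  change p k ∈ closure (Ioo (p k) (b k))
  rw [closure_Ioo hk.ne]
  exact left_mem_Icc.2 hk.le

/-- The finite powers of the range of a family as in `exists_generic_family` are hereditarily
Lindelöf. Given Sorgenfrey-open sets `U i`, let `O` be the union of their Euclidean interiors. The
`U i` lie in the Euclidean closure of `O`, so a tuple covered by some `U i` but outside `O` lies in
a closed nowhere dense set, hence is not generic. Generic tuples are thus handled by the second
countability of the Euclidean topology, the others by the induction hypothesis. -/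
theorem isHereditarilyLindelof_pow {I : Type*} [LinearOrder I] {x : I → ℝ}
    (hI : ∀ a : I, (Iio a).Countable)
    (hx : ∀ (n : ℕ) (U : Set (Fin n → ℝ)), IsOpen U → Dense U → ∃ b : I, ∀ a : Fin n → I,
      Function.Injective a → (∀ i, b ≤ a i) → x ∘ a ∈ U) (n : ℕ) :
    IsHereditarilyLindelof
      {p : Fin n → SorgenfreyLine | ∀ i, p i ∈ range fun a => toReal.symm (x a)} := by
  induction n with
  | zero => exact fun t _ => (subsingleton_of_subsingleton (s := t)).isLindelof
  | succ n ih =>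
    refine fun A hA => isLindelof_of_countable_subcover fun {ι} U hU hAU => ?_
    let O : ι → Set (Fin (n + 1) → ℝ) := fun i =>
      interior {q | (fun k => toReal.symm (q k)) ∈ U i}
    obtain ⟨T, hTc, hT⟩ := TopologicalSpace.isOpen_iUnion_countable O fun _ => isOpen_interior
    have hOo : IsOpen (⋃ i, O i) := isOpen_iUnion fun _ => isOpen_interior
    have hVd : Dense ((⋃ i, O i) ∪ (closure (⋃ i, O i))ᶜ) := by
      rw [dense_iff_closure_eq, closure_union, eq_univ_iff_forall]
      exact fun q => (em (q ∈ closure (⋃ i, O i))).imp id fun h => subset_closure h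
    obtain ⟨b, hb⟩ := hx (n + 1) _ (hOo.union isClosed_closure.isOpen_compl) hVd
    have := (hI b).to_subtype
    -- The exceptional tuples have a coordinate with index below `b`, or two equal coordinates.
    let g : Iio b ⊕ Fin n → (Fin n → SorgenfreyLine) → SorgenfreyLine
      | .inl a, _ => toReal.symm (x a)
      | .inr i, q => q i
    have hg : ∀ s, Continuous (g s) := by
      rintro (a | i)
      · exact continuous_const
      · exact continuous_apply i
    let E : Fin (n + 1) × (Iio b ⊕ Fin n) → Set (Fin (n + 1) → SorgenfreyLine) := fun s =>
      (fun q : Fin n → SorgenfreyLine => Fin.insertNth s.1 (g s.2 q) q) ''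
        {p | ∀ i, p i ∈ range fun a => toReal.symm (x a)}
    have hE : IsLindelof (⋃ s, A ∩ E s) := isLindelof_iUnion fun s =>
      (ih.image ((hg s.2).finInsertNth s.1 continuous_id)).isLindelof_subset inter_subset_right
    obtain ⟨T', hTc', hT'⟩ := hE.elim_countable_subcover U hU
      ((iUnion_subset fun s => inter_subset_left).trans hAU)
    refine ⟨T ∪ T', hTc.union hTc', fun p hp => ?_⟩
    have hmemE : ∀ j s, g s (j.removeNth p) = p j →
        p ∈ ⋃ i ∈ T ∪ T', U i := fun j s h => by
      have hpE : p ∈ ⋃ s, A ∩ E s :=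
        mem_iUnion.2 ⟨(j, s), hp, j.removeNth p, fun i => hA hp _, by
          simp only [h, Fin.insertNth_self_removeNth]⟩
      exact biUnion_subset_biUnion_left subset_union_right (hT' hpE)
    choose a ha using hA hp
    by_cases hab : ∀ i, b ≤ a i
    · by_cases hinj : Function.Injective a
      · obtain ⟨i, hi⟩ := mem_iUnion.1 (hAU hp)
        have hpa : (fun k => toReal.symm ((x ∘ a) k)) = p := funext ha
        have hcl : x ∘ a ∈ closure (⋃ i, O i) :=
          closure_mono (subset_iUnion O i)
            (subset_closure_interior_of_isOpen (hU i) (by rw [mem_ofPred_eq, hpa]; exact hi))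
        have hO : x ∘ a ∈ ⋃ i ∈ T, O i := by
          rw [hT]
          exact (hb a hinj hab).resolve_right (not_not_intro hcl)
        obtain ⟨i', hi', hmem⟩ := mem_iUnion₂.1 hO
        have := interior_subset hmem
        rw [mem_ofPred_eq, hpa] at this
        exact mem_iUnion₂.2 ⟨i', Or.inl hi', this⟩
      · obtain ⟨i, j, hij, hne⟩ := Function.not_injective_iff.1 hinj
        obtain ⟨i', rfl⟩ := Fin.exists_succAbove_eq hne
        exact hmemE j (.inr i') (by
          rw [← ha j, ← hij]
          exact (ha _).symm)
    · push Not at hab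
      obtain ⟨j, hj⟩ := hab
      exact hmemE j (.inl ⟨a j, hj⟩) (ha j)

theorem exists_uncountable_hereditarilyLindelof_pow
    (hCH : Cardinal.aleph.{0} 1 = Cardinal.continuum.{0}) :
    ∃ X : Set SorgenfreyLine, ¬ X.Countable ∧ HereditarilyLindelofSpace (ℕ → X) := by
  obtain ⟨I, _, x, hunc, hI, hinj, hx⟩ := exists_generic_family hCH
  refine ⟨range fun a => toReal.symm (x a), fun h => ?_, .pi_nat fun n => ⟨fun t _ => ?_⟩⟩
  · have := h.to_subtype
    exact not_countable (rangeFactorization_injective.2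
      (show Function.Injective fun a => toReal.symm (x a) from
        toReal.symm.injective.comp hinj)).countable
  · have hind : IsInducing fun (p : Fin n → range fun a => toReal.symm (x a)) k => (p k).1 :=
      IsInducing.piMap fun _ => IsInducing.subtypeVal
    refine hind.isLindelof_iff.2 ((isHereditarilyLindelof_pow hI hx n).isLindelof_subset ?_)
    rintro _ ⟨p, -, rfl⟩ i
    exact (p i).2

/-! ### Step functions -/

/-- The step function `t ↦ 1` if `0 ≤ x + t`, else `0`, as a continuous function of `x`.

Reflecting the jump to `-x` makes the map jointly continuous: moving `x` to the right moves the jump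
to the left, and no Sorgenfrey neighborhood sees points to the left. -/
noncomputable def stepMap : C(SorgenfreyLine, C(SorgenfreyLine, ℝ)) :=
  ContinuousMap.curry
    { toFun := fun p => if 0 ≤ toReal p.1 + toReal p.2 then 1 else 0
      continuous_toFun := by
        refine continuous_iff_continuousAt.2 fun ⟨x, t⟩ => tendsto_nhds_of_eventually_eq ?_
        by_cases h : 0 ≤ toReal x + toReal t
        · have hx := (nhds_hasBasis x).mem_of_mem (lt_add_one (toReal x))
          have ht := (nhds_hasBasis t).mem_of_mem (lt_add_one (toReal t))
          rw [nhds_prod_eq]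
          filter_upwards [prod_mem_prod hx ht] with p hp
          rw [if_pos h, if_pos (h.trans (add_le_add hp.1.1 hp.2.1))]
        · have hc : Continuous fun p : SorgenfreyLine × SorgenfreyLine =>
              toReal p.1 + toReal p.2 :=
            (continuous_toReal.comp continuous_fst).add (continuous_toReal.comp continuous_snd)
          filter_upwards [(isOpen_Iio.preimage hc).mem_nhds (not_le.1 h)] with p hp
          rw [if_neg h, if_neg (not_le.2 hp)] }

theorem stepMap_apply (x t : SorgenfreyLine) :
    stepMap x t = if 0 ≤ toReal x + toReal t then 1 else 0 := rfl

theorem half_lt_stepMap_apply_neg (x : SorgenfreyLine) (a : ℝ) :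
    1 / 2 < stepMap x (toReal.symm (-a)) ↔ a ≤ toReal x := by
  rw [stepMap_apply, Equiv.apply_symm_apply]
  split_ifs with h <;> constructor <;> intro h' <;> linarith

theorem stepMap_apply_neg_lt_half (x : SorgenfreyLine) (a : ℝ) :
    stepMap x (toReal.symm (-a)) < 1 / 2 ↔ toReal x < a := by
  rw [stepMap_apply, Equiv.apply_symm_apply]
  split_ifs with h <;> constructor <;> intro h' <;> linarith

theorem isEmbedding_stepMap : IsEmbedding stepMap := by
  refine ⟨⟨le_antisymm stepMap.continuous.le_induced (le_generateFrom ?_)⟩, fun x y h => ?_⟩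
  · rintro _ ⟨a, b, -, rfl⟩
    refine isOpen_induced_iff.2 ⟨{f | 1 / 2 < f (toReal.symm (-a)) ∧
      f (toReal.symm (-b)) < 1 / 2}, ?_, ?_⟩
    · have hev (c : ℝ) : Continuous fun f : C(SorgenfreyLine, ℝ) => f (toReal.symm c) :=
        continuous_eval_const _
      exact (isOpen_lt continuous_const (hev _)).inter (isOpen_lt (hev _) continuous_const)
    · ext x
      exact and_congr (half_lt_stepMap_apply_neg x a) (stepMap_apply_neg_lt_half x b)
  · apply toReal.injective
    apply le_antisymm
    · rw [← half_lt_stepMap_apply_neg, ← h, half_lt_stepMap_apply_neg]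
    · rw [← half_lt_stepMap_apply_neg, h, half_lt_stepMap_apply_neg]

/-- Under a continuous surjection `M → G`, two distinct points of `X` cannot share a basic open set
of `M` that contains a preimage of `stepMap x` and is mapped into `{g | 1 / 2 < g (-x)}`. -/
theorem not_isCosmic_of_stepMap_mem {X : Set SorgenfreyLine} (hX : ¬ X.Countable)
    {G : Set C(SorgenfreyLine, ℝ)} (hG : ∀ x ∈ X, stepMap x ∈ G) : ¬ IsCosmic G := by
  rintro ⟨M, _, hM, hMs, f, hf, hsurj⟩
  let _ := TopologicalSpace.metrizableSpaceMetric M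
  have := UniformSpace.secondCountable_of_separable M
  have hb := TopologicalSpace.isBasis_countableBasis M
  have hbc := (TopologicalSpace.countable_countableBasis M).to_subtype
  have key : ∀ x : X, ∃ B : TopologicalSpace.countableBasis M,
      (∃ m ∈ B.1, (f m : C(SorgenfreyLine, ℝ)) = stepMap x) ∧
      ∀ m ∈ B.1, 1 / 2 < (f m : C(SorgenfreyLine, ℝ)) (toReal.symm (-toReal x.1)) := by
    intro x
    obtain ⟨m, hm⟩ := hsurj ⟨stepMap x, hG x x.2⟩
    have hm' : (f m : C(SorgenfreyLine, ℝ)) = stepMap x := congrArg Subtype.val hm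
    have ho : IsOpen {m | 1 / 2 < (f m : C(SorgenfreyLine, ℝ)) (toReal.symm (-toReal x.1))} :=
      isOpen_lt continuous_const
        ((continuous_eval_const _).comp (continuous_subtype_val.comp hf))
    obtain ⟨B, hB, hmB, hBs⟩ := hb.exists_subset_of_mem_open
      (show m ∈ {m | 1 / 2 < (f m : C(SorgenfreyLine, ℝ)) (toReal.symm (-toReal x.1))} by
        rw [mem_ofPred_eq, hm']; exact (half_lt_stepMap_apply_neg _ _).2 le_rfl) ho
    exact ⟨⟨B, hB⟩, ⟨m, hmB, hm'⟩, fun m hm => hBs hm⟩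
  choose B hB1 hB2 using key
  have hle : ∀ x y : X, B x = B y → toReal y.1 ≤ toReal x.1 := fun x y h => by
    obtain ⟨m, hm, hmx⟩ := hB1 x
    rw [← half_lt_stepMap_apply_neg, ← hmx]
    exact hB2 y m (h ▸ hm)
  have hinj : Function.Injective B := fun x y h =>
    Subtype.ext (toReal.injective (le_antisymm (hle y x h.symm) (hle x y h)))
  exact hX (countable_coe_iff.1 hinj.countable)

end SorgenfreyLine

/-! ### Groups generated by a subspace -/

/-- The countable power of the subgroup generated by the image of `X` is a continuous image of
`ℕ^ω × X^ω`: one factor chooses the integer coefficients of each coordinate, from an enumeration of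
all finite integer sequences, and the other supplies the generators. -/
theorem HereditarilyLindelofSpace.pi_nat_addSubgroup_closure {H X : Type*} [AddCommGroup H]
    [TopologicalSpace H] [IsTopologicalAddGroup H] [TopologicalSpace X] [Nonempty X]
    [HereditarilyLindelofSpace (ℕ → X)] {e : X → H} (he : Continuous e) :
    HereditarilyLindelofSpace (ℕ → AddSubgroup.closure (range e)) := by
  obtain ⟨c, hc⟩ := exists_surjective_nat (Σ n, Fin n → ℤ)
  let comb : ℕ → (ℕ → X) → H := fun m y => ∑ i : Fin (c m).1, (c m).2 i • e (y i)
  have hcomb : ∀ m y, comb m y ∈ AddSubgroup.closure (range e) := fun m y =>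
    AddSubgroup.sum_mem _ fun i _ => AddSubgroup.zsmul_mem _
      (AddSubgroup.subset_closure (mem_range_self _)) _
  have hcont : Continuous fun p : ℕ × (ℕ → X) => comb p.1 p.2 := by
    refine continuous_prod_of_discrete_left.2 fun m => ?_
    change Continuous fun y : ℕ → X => ∑ i : Fin (c m).1, (c m).2 i • e (y i)
    exact continuous_finsetSum _ fun i _ => (he.comp (continuous_apply (i : ℕ))).zsmul _
  let Φ : (ℕ → ℕ) × (ℕ → X) → ℕ → AddSubgroup.closure (range e) := fun p n =>
    ⟨comb (p.1 n) fun i => p.2 (Nat.pair n i), hcomb (p.1 n) fun i => p.2 (Nat.pair n i)⟩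
  refine .of_surjective (f := Φ) (continuous_pi fun n => Continuous.subtype_mk ?_ _) fun g => ?_
  · exact hcont.comp (f := fun p : (ℕ → ℕ) × (ℕ → X) => (p.1 n, fun i => p.2 (Nat.pair n i)))
      (by fun_prop)
  · have hex : ∀ n, ∃ m y, comb m y = g n := fun n => by
      have hg : (g n : H) ∈ Submodule.span ℤ (range e) := by
        rw [← Submodule.mem_toAddSubgroup, Submodule.span_int_eq_addSubgroupClosure]
        exact (g n).2
      obtain ⟨k, f, s, hs⟩ := Submodule.mem_span_set'.1 hg
      obtain ⟨m, hm⟩ := hc ⟨k, f⟩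
      choose y hy using fun i => (s i).2
      refine ⟨m, fun i => if h : i < k then y ⟨i, h⟩ else Classical.arbitrary X, ?_⟩
      dsimp only [comb]
      rw [hm]
      simp only [Fin.is_lt, dif_pos, hy, hs]
    choose m y hmy using hex
    refine ⟨(m, fun j => y j.unpair.1 j.unpair.2), funext fun n => Subtype.ext ?_⟩
    simp only [Φ, Nat.unpair_pair, hmy]


theorem theorem5 :
    IsKSeparable SorgenfreyLine ∧
    IsCometrizable C(SorgenfreyLine, ℝ) ∧
    (Cardinal.aleph.{0} 1 = Cardinal.continuum.{0} →
      ∃ (X : Set SorgenfreyLine) (e : SorgenfreyLine → C(SorgenfreyLine, ℝ))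
        (G : AddSubgroup C(SorgenfreyLine, ℝ)),
        ¬ X.Countable ∧
        HereditarilyLindelofSpace (ℕ → X) ∧
        IsEmbedding e ∧
        G = AddSubgroup.closure (e '' X) ∧
        IsTopologicalAddGroup G ∧
        IsCometrizable G ∧
        (∃ f : X → G, IsEmbedding f ∧ ∀ x : X, (f x : C(SorgenfreyLine, ℝ)) = e x) ∧
        ¬ IsCosmic G ∧
        HereditarilyLindelofSpace (ℕ → G) ∧
        spread (ℕ → G) ≤ Cardinal.aleph0) := by
  have hcom := SorgenfreyLine.isKSeparable.isCometrizable_continuousMap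
  refine ⟨SorgenfreyLine.isKSeparable, hcom, fun hCH => ?_⟩
  obtain ⟨X, hX, hHL⟩ := SorgenfreyLine.exists_uncountable_hereditarilyLindelof_pow hCH
  have hmem : ∀ x ∈ X, SorgenfreyLine.stepMap x ∈
      AddSubgroup.closure (SorgenfreyLine.stepMap '' X) :=
    fun x hx => AddSubgroup.subset_closure (mem_image_of_mem _ hx)
  have hne : Nonempty X := by
    refine (nonempty_iff_ne_empty.2 fun h => hX ?_).to_subtype
    simp [h]
  have hG : HereditarilyLindelofSpace
      (ℕ → AddSubgroup.closure (SorgenfreyLine.stepMap '' X)) := by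
    rw [image_eq_range]
    exact .pi_nat_addSubgroup_closure
      (SorgenfreyLine.stepMap.continuous.comp continuous_subtype_val)
  refine ⟨X, SorgenfreyLine.stepMap, _, hX, hHL, SorgenfreyLine.isEmbedding_stepMap, rfl,
    inferInstance, hcom.subtype _, ⟨fun x => ⟨SorgenfreyLine.stepMap x, hmem x x.2⟩, ?_,
    fun _ => rfl⟩, SorgenfreyLine.not_isCosmic_of_stepMap_mem hX hmem, hG, spread_le_aleph0 _⟩
  exact (SorgenfreyLine.isEmbedding_stepMap.comp IsEmbedding.subtypeVal).codRestrict _ _
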